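/- Theorem. Let $N$ be a positive square-free integer with $N\equiv 5 \pmod 8$. Put $\mathcal A_N=\mathbb Z[\sqrt N]$ and let $\mathcal O_N$ be the maximal order (ring of integers) of the real quadratic field $\mathbb Q(\sqrt N)\subset\mathbb R$. Let $\epsilon>1$ be the fundamental unit of $\mathcal O_N$, so that every unit of $\mathcal O_N$ is $\pm\epsilon^n$ for some $n\in\mathbb Z$, and let $e\ge 1$ be the integer for which $\epsilon^e$ is the fundamental unit of $\mathcal A_N$, i.e. the units of $\mathcal A_N$ are exactly the elements $\pm\epsilon^{en}$ with $n\in\mathbb Z$. For an order $R$, let $Cl(R)$ be the group of invertible fractional ideals of $R$ modulo principal ones, and let $$\phi: Cl(\mathcal A_N)\rightarrow Cl(\mathcal O_N),\qquad [I]\mapsto [I\mathcal O_N],$$ be the natural homomorphism. Let $[4,\sqrt N+1]$ denote the (invertible) ideal of $\mathcal A_N$ generated by $4$ and $\sqrt N+1$. Then $\phi$ is surjective, and: (a) $\phi$ is an isomorphism if and only if $e=3$. (b) The class of $[4,\sqrt N+1]$ in $Cl(\mathcal A_N)$ has order $3$ and generates the kernel of $\phi$ if and only if $e=1$. -/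

import Mathlib

open scoped NumberField nonZeroDivisors

noncomputable section

namespace Eisenstein

/-- The field `ℚ(√N)`, as a subfield of `ℝ`. -/
abbrev QuadField (N : ℕ) : IntermediateField ℚ ℝ :=
  IntermediateField.adjoin ℚ {√(N : ℝ)}

/-- `√N` as an element of `ℚ(√N)`. -/
def sqrtN (N : ℕ) : QuadField N :=
  ⟨√(N : ℝ), IntermediateField.mem_adjoin_simple_self ℚ _⟩

theorem sqrtN_mul_self (N : ℕ) : sqrtN N * sqrtN N = (N : QuadField N) := by
  apply Subtype.ext
  simp [sqrtN]

/-- The maximal order `𝒪_N`: the ring of integers of `ℚ(√N)`. -/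
abbrev MaxOrder (N : ℕ) : Type := 𝓞 (QuadField N)

/-- `ℤ[√N]` as a subalgebra of `ℚ(√N)`. -/
abbrev sqrtSubalgebra (N : ℕ) : Subalgebra ℤ (QuadField N) :=
  Algebra.adjoin ℤ {sqrtN N}

/-- The order `𝒜_N = ℤ[√N]`, as a ring in its own right. -/
def SqrtOrder (N : ℕ) : Type := sqrtSubalgebra N

instance (N : ℕ) : CommRing (SqrtOrder N) := inferInstanceAs (CommRing (sqrtSubalgebra N))

instance (N : ℕ) : IsDomain (SqrtOrder N) := inferInstanceAs (IsDomain (sqrtSubalgebra N))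

/-- The inclusion `𝒜_N → ℚ(√N)`. -/
def toField (N : ℕ) : SqrtOrder N →+* QuadField N := (sqrtSubalgebra N).val.toRingHom

theorem toField_injective (N : ℕ) : Function.Injective (toField N) :=
  Subtype.val_injective

theorem isIntegral_sqrtN (N : ℕ) : IsIntegral ℤ (sqrtN N) := by
  refine IsIntegral.of_pow (n := 2) (by norm_num) ?_
  rw [pow_two, sqrtN_mul_self]
  exact isIntegral_algebraMap (R := ℤ) (x := (N : ℤ)) |> fun h => by simpa using h

theorem sqrtOrder_le (N : ℕ) : sqrtSubalgebra N ≤ integralClosure ℤ (QuadField N) :=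
  Algebra.adjoin_le (by simpa using! isIntegral_sqrtN N)

/-- The inclusion `𝒜_N → 𝒪_N`. -/
def incl (N : ℕ) : SqrtOrder N →+* MaxOrder N :=
  (Subalgebra.inclusion (sqrtOrder_le N)).toRingHom

theorem incl_injective (N : ℕ) : Function.Injective (incl N) :=
  Subalgebra.inclusion_injective (sqrtOrder_le N)

/-- For an injective homomorphism `f : A → B` of domains, the homomorphism `Cl(A) → Cl(B)`
sending the class of an invertible fractional ideal `I` of `A` to the class of its extension
`I B`. -/
def classGroupMap {A B : Type*} [CommRing A] [IsDomain A] [CommRing B] [IsDomain B]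
    (f : A →+* B) (hf : Function.Injective f) : ClassGroup A →* ClassGroup B :=
  QuotientGroup.map _ _
    (Units.map (FractionalIdeal.extendedHom' (K := FractionRing A) (FractionRing B)
      (nonZeroDivisors_le_comap_nonZeroDivisors_of_injective f hf)).toMonoidHom) (by
    rintro _ ⟨x, rfl⟩
    refine mem_principal_ideals_iff.mpr ⟨IsLocalization.map (FractionRing B) f
      (nonZeroDivisors_le_comap_nonZeroDivisors_of_injective f hf) (x : FractionRing A), ?_⟩
    simp [FractionalIdeal.extended_spanSingleton])

/-- The natural homomorphism `φ : Cl(𝒜_N) → Cl(𝒪_N)`. -/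
def phi (N : ℕ) : ClassGroup (SqrtOrder N) →* ClassGroup (MaxOrder N) :=
  classGroupMap (incl N) (incl_injective N)

/-- The class of an invertible ideal of a domain. -/
def idealClass {A : Type*} [CommRing A] [IsDomain A] (I : Ideal A)
    (hI : IsUnit (I : FractionalIdeal A⁰ (FractionRing A))) : ClassGroup A :=
  ClassGroup.mk (FractionRing A) hI.unit

/-- `√N` as an element of `ℤ[√N]`. -/
def rootN (N : ℕ) : SqrtOrder N := ⟨sqrtN N, Algebra.self_mem_adjoin_singleton ℤ _⟩

theorem rootN_mul_self (N : ℕ) : rootN N * rootN N = (N : SqrtOrder N) := by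
  apply toField_injective N
  rw [map_mul, map_natCast]
  exact sqrtN_mul_self N

/-- The ideal `[4, √N + 1]` of `ℤ[√N]`. -/
def idealI (N : ℕ) : Ideal (SqrtOrder N) := Ideal.span {4, rootN N + 1}

/-- Invertibility of an ideal `(4, r + 1)` with `r ^ 2 = 8 k + 5`: the product with the
conjugate ideal `(4, r - 1)` is the principal ideal `(4)`. -/
theorem isUnit_span_four {A : Type*} [CommRing A] [IsDomain A] (h4 : (4 : A) ≠ 0) (r k : A)
    (hr : r * r = 8 * k + 5) :
    IsUnit ((Ideal.span {4, r + 1} : Ideal A) : FractionalIdeal A⁰ (FractionRing A)) := by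
  have key : (Ideal.span {4, r + 1} : Ideal A) * Ideal.span {4, r - 1} = Ideal.span {4} := by
    rw [Ideal.span_pair_mul_span_pair]
    apply le_antisymm
    · rw [Ideal.span_le]
      rintro x hx
      simp only [Set.mem_insert_iff, Set.mem_singleton_iff] at hx
      rw [SetLike.mem_coe, Ideal.mem_span_singleton]
      rcases hx with rfl | rfl | rfl | rfl
      · exact ⟨4, by ring⟩
      · exact ⟨r - 1, by ring⟩
      · exact ⟨r + 1, by ring⟩
      · exact ⟨2 * k + 1, by linear_combination hr⟩
    · rw [Ideal.span_singleton_le_iff_mem]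
      set J : Ideal A := Ideal.span _ with hJ
      have h2 : 4 * (r - 1) ∈ J := Ideal.subset_span (by simp)
      have h3 : (r + 1) * 4 ∈ J := Ideal.subset_span (by simp)
      have h5 : (r + 1) * (r - 1) ∈ J := Ideal.subset_span (by simp)
      have h8 : (8 : A) ∈ J := by
        have := J.sub_mem h3 h2
        convert this using 1; ring
      have := J.sub_mem h5 (J.mul_mem_left k h8)
      convert this using 1
      linear_combination -hr
  have h4' : algebraMap A (FractionRing A) 4 ≠ 0 :=
    (map_ne_zero_iff _ (IsFractionRing.injective A (FractionRing A))).mpr h4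
  refine IsUnit.of_mul_eq_one
    (((Ideal.span {4, r - 1} : Ideal A) : FractionalIdeal A⁰ (FractionRing A)) *
      FractionalIdeal.spanSingleton _ (algebraMap A (FractionRing A) 4)⁻¹) ?_
  rw [← mul_assoc, ← FractionalIdeal.coeIdeal_mul, key,
    FractionalIdeal.coeIdeal_span_singleton, FractionalIdeal.spanSingleton_mul_spanSingleton,
    mul_inv_cancel₀ h4', FractionalIdeal.spanSingleton_one]

theorem isUnit_idealI (N : ℕ) (hN : N ≡ 5 [MOD 8]) :
    IsUnit (idealI N : FractionalIdeal (SqrtOrder N)⁰ (FractionRing (SqrtOrder N))) := by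
  refine isUnit_span_four ?_ (rootN N) ((N / 8 : ℕ) : SqrtOrder N) ?_
  · intro h
    have h' := congrArg (toField N) h
    rw [map_ofNat, map_zero] at h'
    exact absurd h' (by norm_num)
  · have h : N = 8 * (N / 8) + 5 := by unfold Nat.ModEq at hN; omega
    rw [rootN_mul_self]
    exact_mod_cast congrArg (Nat.cast (R := SqrtOrder N)) h

/-- The class of the ideal `[4, √N + 1]` in `Cl(𝒜_N)`. -/
def classI (N : ℕ) (hN : N ≡ 5 [MOD 8]) : ClassGroup (SqrtOrder N) :=
  idealClass (idealI N) (isUnit_idealI N hN)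

/-- `u` is the fundamental unit of a ring `R` of real numbers (given with its inclusion
`f : R → ℝ`): it is greater than `1`, and every unit of `R` is `± uⁿ` for some integer `n`. -/
def IsFundamentalUnit {R : Type*} [CommRing R] (f : R →+* ℝ) (u : Rˣ) : Prop :=
  1 < f u ∧ ∀ v : Rˣ, ∃ n : ℤ, v = u ^ n ∨ v = -u ^ n

/-- The inclusion `𝒪_N → ℝ`. -/
def maxOrderToReal (N : ℕ) : MaxOrder N →+* ℝ :=
  (algebraMap (QuadField N) ℝ).comp (algebraMap (MaxOrder N) (QuadField N))

/-- The inclusion `𝒜_N → ℝ`. -/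
def sqrtOrderToReal (N : ℕ) : SqrtOrder N →+* ℝ :=
  (algebraMap (QuadField N) ℝ).comp (toField N)

/-- `e` is the exponent for which the fundamental unit of `𝒜_N` is `ε ^ e`, with `ε` the
fundamental unit of `𝒪_N`. -/
def IsUnitExponent (N e : ℕ) : Prop :=
  ∃ (ε : (MaxOrder N)ˣ) (η : (SqrtOrder N)ˣ),
    IsFundamentalUnit (maxOrderToReal N) ε ∧
    IsFundamentalUnit (sqrtOrderToReal N) η ∧
    Units.map (incl N).toMonoidHom η = ε ^ e

end Eisenstein

end

/-! Write `O = ℤ[w]` with `w = (1 + √N)/2` and `A = ℤ[√N]`. Since `w² = w + (2k + 1)`, the prime 2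
is inert: `O/2O` is the field of four elements `{0, 1, w, w - 1}`, and `A` is the preimage of its
prime field. In particular `2O ⊆ A`, and everything is decided by residues modulo 2.

Kernel: let `I` be an invertible ideal of `A` with `IO = zO`. The group `L = z⁻¹I` lies between `2O`
and `O`. It is not `2O`, since `IO` would shrink, and not `O`, since invertibility would force `w ∈
A`. So `L/2O` is one of the three lines spanned by `1`, `w`, `w - 1`, and `I` is respectively
principal, in the class of `(4, r + 1)`, or in the class of its square
(`trichotomy_of_map_eq_span`). As `(4, r + 1)³ = (8)`, the kernel is generated by a class of order 1
or 3.

Units: that class is trivial exactly when some unit of `O` lies outside `A`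
(`exists_eq_span_singleton_iff`), that is, when `e ≠ 1`. Cubes are trivial in the residue field's
unit group, so `ε³ ∈ A` and `e` divides 3.

Surjectivity: up to a power of 2, an ideal of `O` contains an odd integer, and such an ideal is
extended from its contraction to `A`, which is invertible (`exists_map_eq`). -/

namespace Eisenstein

/-- `f : A → O` exhibits `A = ℤ[r]` as the suborder of index two in `O = ℤ[w]`, where
`r = 2 w - 1` and `w ^ 2 = w + (2 k + 1)`. -/
structure IsHalfOrder {A O : Type*} [CommRing A] [CommRing O] (f : A →+* O) (r : A) (w : O)
    (k : ℤ) : Prop where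
  injective : Function.Injective f
  exists_eq : ∀ x : O, ∃ a b : ℤ, x = a + b * w
  eq_zero : ∀ a b : ℤ, (a : O) + b * w = 0 → a = 0 ∧ b = 0
  exists_eq_sub : ∀ x : A, ∃ a b : ℤ, x = a + b * r
  map_root : f r = 2 * w - 1
  sq : w * w = w + (2 * k + 1)

namespace IsHalfOrder

variable {A O : Type*} [CommRing A] [CommRing O] {f : A →+* O} {r : A} {w : O} {k : ℤ}

/-! ### Residues modulo 2 -/

theorem two_mul_mem_range (h : IsHalfOrder f r w k) (x : O) : ∃ a, f a = 2 * x := by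
  obtain ⟨a, b, rfl⟩ := h.exists_eq x
  refine ⟨2 * a + b + b * r, ?_⟩
  simp only [map_add, map_mul, map_intCast, map_ofNat, h.map_root]
  ring

theorem one_add_mem_range (h : IsHalfOrder f r w k) (x : O) : ∃ a, f a = 1 + 2 * x := by
  obtain ⟨a, ha⟩ := h.two_mul_mem_range x
  exact ⟨1 + a, by simp [ha]⟩

/-- These are the four elements of `O/2O`; all later case distinctions go through them. -/
theorem residue (h : IsHalfOrder f r w k) (x : O) :
    ∃ y, x = 2 * y ∨ x = 1 + 2 * y ∨ x = w + 2 * y ∨ x = w - 1 + 2 * y := by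
  obtain ⟨a, b, rfl⟩ := h.exists_eq x
  rcases Int.even_or_odd' a with ⟨c, rfl | rfl⟩ <;> rcases Int.even_or_odd' b with ⟨d, rfl | rfl⟩
  · exact ⟨c + d * w, .inl (by push_cast; ring)⟩
  · exact ⟨c + d * w, .inr (.inr (.inl (by push_cast; ring)))⟩
  · exact ⟨c + d * w, .inr (.inl (by push_cast; ring))⟩
  · exact ⟨c + 1 + d * w, .inr (.inr (.inr (by push_cast; ring)))⟩

theorem not_mem_range (h : IsHalfOrder f r w k) (a : A) : f a ≠ w := by
  obtain ⟨c, d, rfl⟩ := h.exists_eq_sub a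
  intro hw
  simp only [map_add, map_mul, map_intCast, h.map_root] at hw
  have := (h.eq_zero (c - d) (2 * d - 1) (by push_cast; linear_combination hw)).2
  omega

theorem two_mul_ne_one (h : IsHalfOrder f r w k) (x : O) : 2 * x ≠ 1 := by
  obtain ⟨a, b, rfl⟩ := h.exists_eq x
  intro hx
  have := (h.eq_zero (2 * a - 1) (2 * b) (by push_cast; linear_combination hx)).1
  omega

theorem two_ne_zero (h : IsHalfOrder f r w k) : (2 : O) ≠ 0 := by
  intro h2
  have := (h.eq_zero 2 0 (by push_cast; linear_combination h2)).1
  omega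

theorem intCast_ne_zero (h : IsHalfOrder f r w k) {n : ℤ} (hn : n ≠ 0) : (n : A) ≠ 0 := by
  intro h2
  have := congrArg f h2
  rw [map_intCast, map_zero] at this
  exact hn (h.eq_zero n 0 (by simpa using this)).1

theorem root_mul_self (h : IsHalfOrder f r w k) : r * r = 8 * k + 5 := by
  apply h.injective
  simp only [map_add, map_mul, map_intCast, map_ofNat, h.map_root]
  linear_combination 4 * h.sq

/-! ### The ideals `(4, r + 1)` and `(4, r - 1)` -/

theorem span_mul_conj (h : IsHalfOrder f r w k) :
    (Ideal.span {4, r + 1} : Ideal A) * Ideal.span {4, r - 1} = Ideal.span {4} := by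
  have hr := h.root_mul_self
  rw [Ideal.span_pair_mul_span_pair]
  apply le_antisymm
  · rw [Ideal.span_le]
    rintro x hx
    simp only [Set.mem_insert_iff, Set.mem_singleton_iff] at hx
    rw [SetLike.mem_coe, Ideal.mem_span_singleton]
    rcases hx with rfl | rfl | rfl | rfl
    · exact ⟨4, by ring⟩
    · exact ⟨r - 1, by ring⟩
    · exact ⟨r + 1, by ring⟩
    · exact ⟨2 * k + 1, by linear_combination hr⟩
  · rw [Ideal.span_singleton_le_iff_mem]
    set J : Ideal A := Ideal.span _ with hJ
    have h2 : 4 * (r - 1) ∈ J := Ideal.subset_span (by simp)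
    have h3 : (r + 1) * 4 ∈ J := Ideal.subset_span (by simp)
    have h5 : (r + 1) * (r - 1) ∈ J := Ideal.subset_span (by simp)
    -- `(r + 1)(r - 1) = 8k + 4` and `4(r + 1) - 4(r - 1) = 8`.
    have := J.sub_mem h5 (J.mul_mem_left (k : A) (J.sub_mem h3 h2))
    convert this using 1
    linear_combination -hr

/-- Reflects `w² ≡ w - 1` modulo 2, since `r + 1` and `r - 1` map to `2w` and `2(w - 1)`. The
computation rests on `(r + 1)² = 2(r - 1) + 8(k + 1)`. -/
theorem span_mul_self (h : IsHalfOrder f r w k) :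
    (Ideal.span {4, r + 1} : Ideal A) * Ideal.span {4, r + 1} =
      Ideal.span {2} * Ideal.span {4, r - 1} := by
  have hr := h.root_mul_self
  rw [Ideal.span_pair_mul_span_pair, Ideal.span_mul_span']
  apply le_antisymm
  · rw [Ideal.span_le]
    set J : Ideal A := Ideal.span _ with hJ
    have h2 : 2 * 4 ∈ J := Ideal.subset_span ⟨2, by simp, 4, by simp, by simp⟩
    have h3 : 2 * (r - 1) ∈ J := Ideal.subset_span ⟨2, by simp, r - 1, by simp, by simp⟩
    have h4 : 4 * (r + 1) ∈ J := by
      convert J.add_mem (J.mul_mem_left 2 h3) h2 using 1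
      ring
    rintro x hx
    simp only [Set.mem_insert_iff, Set.mem_singleton_iff] at hx
    rw [SetLike.mem_coe]
    rcases hx with rfl | rfl | rfl | rfl
    · convert J.mul_mem_left 2 h2 using 1; ring
    · exact h4
    · rwa [mul_comm]
    · convert J.add_mem h3 (J.mul_mem_left ((k : A) + 1) h2) using 1
      linear_combination hr
  · rw [Ideal.span_le]
    set J : Ideal A := Ideal.span _ with hJ
    have h2 : (4 : A) * 4 ∈ J := Ideal.subset_span (by simp)
    have h3 : 4 * (r + 1) ∈ J := Ideal.subset_span (by simp)
    have h5 : (r + 1) * (r + 1) ∈ J := Ideal.subset_span (by simp)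
    -- `2(r + 1)² - 4(r + 1) - 16k = 8`.
    have h8 : (2 : A) * 4 ∈ J := by
      convert J.sub_mem (J.sub_mem (J.mul_mem_left 2 h5) h3) (J.mul_mem_left (k : A) h2) using 1
      linear_combination -2 * hr
    rintro _ ⟨x, hx, y, hy, rfl⟩
    simp only [Set.mem_insert_iff, Set.mem_singleton_iff] at hx hy
    rw [SetLike.mem_coe]
    rcases hx with rfl
    rcases hy with rfl | rfl
    · exact h8
    · convert J.sub_mem h5 (J.mul_mem_left ((k : A) + 1) h8) using 1
      linear_combination -hr

theorem span_pow_three (h : IsHalfOrder f r w k) :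
    (Ideal.span {4, r + 1} : Ideal A) ^ 3 = Ideal.span {8} := by
  rw [pow_succ', pow_two, h.span_mul_self, mul_left_comm, h.span_mul_conj,
    Ideal.span_singleton_mul_span_singleton]
  norm_num

theorem map_span (h : IsHalfOrder f r w k) :
    (Ideal.span {4, r + 1} : Ideal A).map f = Ideal.span {2} := by
  rw [Ideal.map_span, Set.image_pair, map_add, h.map_root, map_one, map_ofNat]
  apply le_antisymm
  · rw [Ideal.span_le]
    rintro x hx
    simp only [Set.mem_insert_iff, Set.mem_singleton_iff] at hx
    rw [SetLike.mem_coe, Ideal.mem_span_singleton]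
    rcases hx with rfl | rfl
    · exact ⟨2, by ring⟩
    · exact ⟨w, by ring⟩
  · rw [Ideal.span_singleton_le_iff_mem, Ideal.mem_span_pair]
    -- The generators are `4` and `2w`, and `w(w - 1) = 2k + 1` is odd.
    exact ⟨-k, w - 1, by linear_combination 2 * h.sq⟩

/-! ### Ideals whose extension is principal -/

/-- Because `2O ⊆ A`, doubling carries `IO` back into `I`. The quantifier over `x` is what lets the
induction pass through scalars from `O`. -/
theorem exists_mem_two_mul (h : IsHalfOrder f r w k) (I : Ideal A) {y : O} (hy : y ∈ I.map f) :
    ∀ x : O, ∃ i ∈ I, f i = 2 * x * y := by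
  induction hy using Submodule.span_induction with
  | mem y hy =>
    obtain ⟨i, hi, rfl⟩ := hy
    intro x
    obtain ⟨a, ha⟩ := h.two_mul_mem_range x
    exact ⟨a * i, I.mul_mem_left _ hi, by rw [map_mul, ha]⟩
  | zero => exact fun x => ⟨0, I.zero_mem, by simp⟩
  | add y z _ _ hy hz =>
    intro x
    obtain ⟨i, hi, hi'⟩ := hy x
    obtain ⟨j, hj, hj'⟩ := hz x
    exact ⟨i + j, I.add_mem hi hj, by rw [map_add, hi', hj']; ring⟩
  | smul a y _ hy =>
    intro x
    obtain ⟨i, hi, hi'⟩ := hy (x * a)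
    exact ⟨i, hi, by rw [hi', smul_eq_mul]; ring⟩

/-- The hypotheses say `I = zL` with `L = ℤu + 2O`. The ideal `(4, s)` is `2L`, because `1` and `u`
span `O` and hence `4O ⊆ (4, s)`; so `4I = 2z · 2L`. Applied with `u = w` and `u = w - 1`. -/
theorem span_four_mul_eq [IsDomain A] [IsDomain O] (h : IsHalfOrder f r w k) {I : Ideal A}
    {z u : O} {s t : A} (ht : f t = 2 * z) (hs : f s = 2 * u) (htI : t ∈ I)
    (hu : ∃ i ∈ I, f i = z * u) (hI : ∀ i ∈ I, ∃ y, f i = z * (2 * y) ∨ f i = z * (u + 2 * y))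
    (hrep : ∀ y : O, ∃ a b : ℤ, y = a + b * u) :
    Ideal.span {4} * I = Ideal.span {t} * Ideal.span {4, s} := by
  have h4 (y : O) : ∃ a ∈ (Ideal.span {4, s} : Ideal A), f a = 4 * y := by
    obtain ⟨a, b, rfl⟩ := hrep y
    refine ⟨a * 4 + 2 * b * s, Ideal.mem_span_pair.mpr ⟨_, _, rfl⟩, ?_⟩
    simp only [map_add, map_mul, map_intCast, map_ofNat, hs]
    ring
  apply le_antisymm
  · intro x hx
    obtain ⟨i, hi, rfl⟩ := Ideal.mem_span_singleton_mul.mp hx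
    rw [Ideal.mem_span_singleton_mul]
    obtain ⟨y, hy | hy⟩ := hI i hi <;> obtain ⟨a, ha, ha'⟩ := h4 y
    · refine ⟨a, ha, h.injective ?_⟩
      rw [map_mul, map_mul, ht, ha', hy, map_ofNat]
      ring
    · refine ⟨s + a, Ideal.add_mem _ (Ideal.subset_span (by simp)) ha, h.injective ?_⟩
      rw [map_mul, map_mul, ht, map_add, ha', hy, hs, map_ofNat]
      ring
  · rw [Ideal.span_mul_span', Ideal.span_le]
    rintro _ ⟨x, hx, y, hy, rfl⟩
    simp only [Set.mem_insert_iff, Set.mem_singleton_iff] at hx hy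
    rw [SetLike.mem_coe, Ideal.mem_span_singleton_mul]
    rcases hx with rfl
    rcases hy with rfl | rfl
    · exact ⟨x, htI, by simp [mul_comm]⟩
    · obtain ⟨i, hi, hi'⟩ := hu
      refine ⟨i, hi, h.injective ?_⟩
      simp only [map_mul, map_ofNat, hi', ht, hs]
      ring

theorem trichotomy_of_map_eq_span [IsDomain A] [IsDomain O] (h : IsHalfOrder f r w k)
    {I J : Ideal A} {a : A} (ha : a ≠ 0) (hIJ : I * J = Ideal.span {a}) {z : O} (hz : z ≠ 0)
    (hI : I.map f = Ideal.span {z}) :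
    (∃ x, x ≠ 0 ∧ I = Ideal.span {x}) ∨
    (∃ x y, x ≠ 0 ∧ y ≠ 0 ∧ Ideal.span {x} * I = Ideal.span {y} * Ideal.span {4, r + 1}) ∨
    (∃ x y, x ≠ 0 ∧ y ≠ 0 ∧ Ideal.span {x} * I =
      Ideal.span {y} * (Ideal.span {4, r + 1} * Ideal.span {4, r + 1})) := by
  have hdvd : ∀ i ∈ I, ∃ x, f i = z * x := fun i hi =>
    Ideal.mem_span_singleton.mp (hI ▸ Ideal.mem_map_of_mem f hi)
  -- `L = z⁻¹I`; it contains `2O`, so membership depends only on the residue modulo 2.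
  let L : AddSubgroup O :=
    { carrier := {x | ∃ i ∈ I, f i = z * x}
      zero_mem' := ⟨0, I.zero_mem, by simp⟩
      add_mem' := by
        rintro x y ⟨i, hi, hi'⟩ ⟨j, hj, hj'⟩
        exact ⟨i + j, I.add_mem hi hj, by rw [map_add, hi', hj']; ring⟩
      neg_mem' := by
        rintro x ⟨i, hi, hi'⟩
        exact ⟨-i, I.neg_mem hi, by rw [map_neg, hi']; ring⟩ }
  have hL2 (x : O) : 2 * x ∈ L := by
    obtain ⟨i, hi, hi'⟩ := h.exists_mem_two_mul I (hI ▸ Ideal.mem_span_singleton_self z) x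
    exact ⟨i, hi, by rw [hi']; ring⟩
  have hshift {x y : O} : x + 2 * y ∈ L ↔ x ∈ L := L.add_mem_cancel_right (hL2 y)
  have hnotall : ¬ (1 ∈ L ∧ w ∈ L) := by
    rintro ⟨h1, hw⟩
    have hL (x : O) : x ∈ L := by
      obtain ⟨a, b, rfl⟩ := h.exists_eq x
      refine L.add_mem ?_ ?_
      · simpa using L.zsmul_mem h1 a
      · simpa using L.zsmul_mem hw b
    -- If `L = O`, then `I` is stable under `w`, hence so is `IJ = aA`; cancelling `a` puts `w` in
    -- `A`.
    have key : ∀ p ∈ I * J, ∃ q ∈ I * J, f q = w * f p := by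
      intro p hp
      induction hp using Submodule.mul_induction_on' with
      | mem_mul_mem i hi j hj =>
        obtain ⟨x, hx⟩ := hdvd i hi
        obtain ⟨i', hi', hx'⟩ := hL (w * x)
        exact ⟨i' * j, Ideal.mul_mem_mul hi' hj, by rw [map_mul, map_mul, hx, hx']; ring⟩
      | add x _ y _ hx hy =>
        obtain ⟨i, hi, hi'⟩ := hx
        obtain ⟨j, hj, hj'⟩ := hy
        exact ⟨i + j, Ideal.add_mem _ hi hj, by rw [map_add, hi', hj', map_add]; ring⟩
    obtain ⟨q, hq, hq'⟩ := key a (hIJ ▸ Ideal.mem_span_singleton_self a)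
    rw [hIJ, Ideal.mem_span_singleton] at hq
    obtain ⟨b, rfl⟩ := hq
    refine h.not_mem_range b (mul_left_cancel₀ ((map_ne_zero_iff f h.injective).mpr ha) ?_)
    rw [← map_mul, hq', mul_comm]
  -- If `L` met no nonzero residue, then `IO ⊆ 2zO`, making 2 invertible.
  have hcases : 1 ∈ L ∨ w ∈ L ∨ w - 1 ∈ L := by
    by_contra! hcon
    have hle : Ideal.span {z} ≤ Ideal.span {2 * z} := by
      rw [← hI, Ideal.map_le_iff_le_comap]
      intro i hi
      obtain ⟨x, hx⟩ := hdvd i hi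
      have hxL : x ∈ L := ⟨i, hi, hx⟩
      rw [Ideal.mem_comap, Ideal.mem_span_singleton]
      obtain ⟨y, rfl | rfl | rfl | rfl⟩ := h.residue x
      · exact ⟨y, by rw [hx]; ring⟩
      · exact absurd (hshift.mp hxL) hcon.1
      · exact absurd (hshift.mp hxL) hcon.2.1
      · exact absurd (hshift.mp hxL) hcon.2.2
    obtain ⟨y, hy⟩ := Ideal.span_singleton_le_span_singleton.mp hle
    exact h.two_mul_ne_one y (mul_left_cancel₀ hz (by linear_combination -hy))
  obtain ⟨t, ht⟩ := h.two_mul_mem_range z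
  have htI : t ∈ I := by
    obtain ⟨i, hi, hi'⟩ := hL2 1
    rwa [h.injective (a₁ := t) (a₂ := i) (by rw [ht, hi']; ring)]
  have ht0 : t ≠ 0 := by
    rintro rfl
    rw [map_zero] at ht
    exact mul_ne_zero h.two_ne_zero hz ht.symm
  have h40 : (4 : A) ≠ 0 := by simpa using h.intCast_ne_zero (n := 4) (by norm_num)
  have h20 : (2 : A) ≠ 0 := by simpa using h.intCast_ne_zero (n := 2) (by norm_num)
  rcases hcases with h1 | hw | hw
  · left
    have hw : w ∉ L := fun hw => hnotall ⟨h1, hw⟩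
    have hw' : w - 1 ∉ L := fun hw' => hw (by simpa using L.add_mem hw' h1)
    obtain ⟨i, hi, hi'⟩ := h1
    refine ⟨i, ?_, le_antisymm (fun j hj => ?_) ((Ideal.span_singleton_le_iff_mem _).mpr hi)⟩
    · rintro rfl
      rw [map_zero, mul_one] at hi'
      exact hz hi'.symm
    obtain ⟨x, hx⟩ := hdvd j hj
    have hxL : x ∈ L := ⟨j, hj, hx⟩
    have hxr : ∃ b, f b = x := by
      obtain ⟨y, rfl | rfl | rfl | rfl⟩ := h.residue x
      · exact h.two_mul_mem_range y
      · exact h.one_add_mem_range y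
      · exact absurd (hshift.mp hxL) hw
      · exact absurd (hshift.mp hxL) hw'
    obtain ⟨b, rfl⟩ := hxr
    exact Ideal.mem_span_singleton.mpr ⟨b, h.injective (by rw [hx, map_mul, hi', mul_one])⟩
  · right; left
    have h1 : (1 : O) ∉ L := fun h1 => hnotall ⟨h1, hw⟩
    have hw' : w - 1 ∉ L := fun hw' => h1 (by simpa using L.sub_mem hw hw')
    refine ⟨4, t, h40, ht0, h.span_four_mul_eq ht (u := w) ?_ htI hw (fun i hi => ?_) h.exists_eq⟩
    · rw [map_add, h.map_root, map_one]; ring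
    obtain ⟨x, hx⟩ := hdvd i hi
    have hxL : x ∈ L := ⟨i, hi, hx⟩
    obtain ⟨y, rfl | rfl | rfl | rfl⟩ := h.residue x
    · exact ⟨y, .inl hx⟩
    · exact absurd (hshift.mp hxL) h1
    · exact ⟨y, .inr hx⟩
    · exact absurd (hshift.mp hxL) hw'
  · right; right
    have h1 : (1 : O) ∉ L := fun h1 => hnotall ⟨h1, by simpa using L.add_mem hw h1⟩
    have hw' : w ∉ L := fun hw' => h1 (by simpa using L.sub_mem hw' hw)
    -- `4I = t(4, r - 1)` is doubled to replace `2(4, r - 1)` by `(4, r + 1)²`.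
    refine ⟨2 * 4, t, mul_ne_zero h20 h40, ht0, ?_⟩
    rw [← Ideal.span_singleton_mul_span_singleton, mul_assoc,
      h.span_four_mul_eq ht (s := r - 1) (u := w - 1) ?_ htI hw (fun i hi => ?_) (fun y => ?_),
      h.span_mul_self, mul_left_comm]
    · rw [map_sub, h.map_root, map_one]; ring
    · obtain ⟨x, hx⟩ := hdvd i hi
      have hxL : x ∈ L := ⟨i, hi, hx⟩
      obtain ⟨y, rfl | rfl | rfl | rfl⟩ := h.residue x
      · exact ⟨y, .inl hx⟩
      · exact absurd (hshift.mp hxL) h1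
      · exact absurd (hshift.mp hxL) hw'
      · exact ⟨y, .inr hx⟩
    · obtain ⟨a, b, rfl⟩ := h.exists_eq y
      exact ⟨a + b, b, by push_cast; ring⟩

/-! ### Units -/

/-- The multiplicative group of `O/2O` has order 3, so `u³ ≡ 1` modulo 2. -/
theorem unit_pow_three_mem_range (h : IsHalfOrder f r w k) (u : Oˣ) :
    ∃ a, f a = (u : O) ^ 3 := by
  have hsq := h.sq
  suffices H : ∃ x, (u : O) ^ 3 = 1 + 2 * x by
    obtain ⟨x, hx⟩ := H
    rw [hx]
    exact h.one_add_mem_range x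
  obtain ⟨y, hy | hy | hy | hy⟩ := h.residue (u : O)
  · exact absurd (by rw [← mul_assoc, ← hy, u.mul_inv]) (h.two_mul_ne_one (y * ↑u⁻¹))
  · exact ⟨3 * y + 6 * y ^ 2 + 4 * y ^ 3, by rw [hy]; ring⟩
  · refine ⟨w + k + k * w + 3 * w ^ 2 * y + 6 * w * y ^ 2 + 4 * y ^ 3, ?_⟩
    rw [hy]; linear_combination (w + 1) * hsq
  · refine ⟨w + k * w - 2 * k - 2 + 3 * (w - 1) ^ 2 * y + 6 * (w - 1) * y ^ 2 + 4 * y ^ 3, ?_⟩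
    rw [hy]; linear_combination (w - 2) * hsq

theorem exists_unit_of_not_mem_range (h : IsHalfOrder f r w k) (u : Oˣ) (hu : ∀ a, f a ≠ u) :
    ∃ (v : Oˣ) (y : O), (v : O) = w + 2 * y := by
  obtain ⟨y, hy | hy | hy | hy⟩ := h.residue (u : O)
  · obtain ⟨a, ha⟩ := h.two_mul_mem_range y
    exact absurd (ha.trans hy.symm) (hu a)
  · obtain ⟨a, ha⟩ := h.one_add_mem_range y
    exact absurd (ha.trans hy.symm) (hu a)
  · exact ⟨u, y, hy⟩
  -- `(w - 1)² ≡ w` modulo 2.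
  · refine ⟨u ^ 2, k + 1 - w + 2 * (w - 1) * y + 2 * y ^ 2, ?_⟩
    rw [Units.val_pow_eq_pow_val, hy]
    linear_combination h.sq

/-- If `(4, r + 1) = (x)`, extending to `O` gives `f x = 2u` with `u` a unit; `u ∈ A` would give `w
∈ A`, because `x` divides `r + 1`. Conversely a unit outside `A`, or its square, is some `v ≡ w`
modulo 2, and `2v` generates the ideal. -/
theorem exists_eq_span_singleton_iff [IsDomain A] [IsDomain O] (h : IsHalfOrder f r w k) :
    (∃ x, x ≠ 0 ∧ (Ideal.span {4, r + 1} : Ideal A) = Ideal.span {x}) ↔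
      ∃ u : Oˣ, ∀ a, f a ≠ u := by
  constructor
  · rintro ⟨x, -, hx⟩
    have hmap := h.map_span
    rw [hx, Ideal.map_span, Set.image_singleton, Ideal.span_singleton_eq_span_singleton] at hmap
    obtain ⟨u, hu⟩ := hmap.symm
    refine ⟨u, fun b hb => ?_⟩
    have hmem : r + 1 ∈ (Ideal.span {x} : Ideal A) := hx ▸ Ideal.subset_span (by simp)
    obtain ⟨q, hq⟩ := Ideal.mem_span_singleton.mp hmem
    refine h.not_mem_range (b * q) (mul_left_cancel₀ h.two_ne_zero ?_)
    have := congrArg f hq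
    rw [map_add, h.map_root, map_one, map_mul, ← hu] at this
    rw [map_mul, hb]
    linear_combination -this
  · rintro ⟨u, hu⟩
    obtain ⟨v, y, hv⟩ := h.exists_unit_of_not_mem_range u hu
    obtain ⟨t, ht⟩ := h.two_mul_mem_range (v : O)
    have hinv : (v : O) * ↑v⁻¹ = 1 := v.mul_inv
    refine ⟨t, ?_, le_antisymm ?_ ?_⟩
    · rintro rfl
      rw [map_zero] at ht
      exact mul_ne_zero h.two_ne_zero v.ne_zero ht.symm
    · rw [Ideal.span_le]
      intro x hx
      simp only [Set.mem_insert_iff, Set.mem_singleton_iff] at hx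
      rw [SetLike.mem_coe, Ideal.mem_span_singleton]
      rcases hx with rfl | rfl
      · obtain ⟨b, hb⟩ := h.two_mul_mem_range (↑v⁻¹ : O)
        refine ⟨b, h.injective ?_⟩
        rw [map_ofNat, map_mul, ht, hb]
        linear_combination -4 * hinv
      · obtain ⟨b, hb⟩ := h.one_add_mem_range (-(↑v⁻¹ * y))
        refine ⟨b, h.injective ?_⟩
        rw [map_add, h.map_root, map_one, map_mul, ht, hb]
        linear_combination -2 * hv + 4 * y * hinv
    · rw [Ideal.span_singleton_le_iff_mem, Ideal.mem_span_pair]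
      obtain ⟨a, b, rfl⟩ := h.exists_eq y
      refine ⟨a, 1 + 2 * b, h.injective ?_⟩
      simp only [map_add, map_mul, map_intCast, map_ofNat, map_one, h.map_root, ht, hv]
      ring

/-! ### Ideals coprime to two -/

/-- The norm `a² + ab - (2k + 1)b²` of `a + bw` is even only when `a` and `b` both are. It lies in
`J`, being a multiple of `a + bw` by its conjugate `a + b - bw`. -/
theorem exists_odd_mem (h : IsHalfOrder f r w k) {J : Ideal O}
    (hJ : ¬ J ≤ Ideal.span {2}) : ∃ m : ℤ, ((2 * m + 1 : ℤ) : O) ∈ J := by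
  obtain ⟨x, hx, hx2⟩ := SetLike.not_le_iff_exists.mp hJ
  rw [Ideal.mem_span_singleton] at hx2
  obtain ⟨a, b, rfl⟩ := h.exists_eq x
  have hn : ((a * a + a * b - b * b * (2 * k + 1) : ℤ) : O) ∈ J := by
    convert J.mul_mem_right ((a : O) + b - b * w) hx using 1
    push_cast
    linear_combination (b : O) ^ 2 * h.sq
  have hodd : Odd (a * a + a * b - b * b * (2 * k + 1)) := by
    by_contra heven
    have hab : Even a ∧ Even b := by
      rw [Int.not_odd_iff_even] at heven
      simp only [Int.even_sub, Int.even_add, Int.even_mul] at heven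
      have : ¬ Even (1 : ℤ) := by decide
      have : Even (2 : ℤ) := by decide
      tauto
    obtain ⟨⟨c, rfl⟩, ⟨d, rfl⟩⟩ := hab
    exact hx2 ⟨c + d * w, by push_cast; ring⟩
  obtain ⟨m, hm⟩ := hodd
  exact ⟨m, hm ▸ hn⟩

theorem map_comap (h : IsHalfOrder f r w k) {J : Ideal O} {m : ℤ}
    (hm : ((2 * m + 1 : ℤ) : O) ∈ J) : (J.comap f).map f = J := by
  refine le_antisymm Ideal.map_comap_le fun x hx => ?_
  have h1 : ((2 * m + 1 : ℤ) : O) ∈ (J.comap f).map f := by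
    have : ((2 * m + 1 : ℤ) : A) ∈ J.comap f := by rwa [Ideal.mem_comap, map_intCast]
    rw [← map_intCast f]
    exact Ideal.mem_map_of_mem f this
  have h2 : 2 * x ∈ (J.comap f).map f := by
    obtain ⟨a, ha⟩ := h.two_mul_mem_range x
    rw [← ha]
    exact Ideal.mem_map_of_mem f (by rw [Ideal.mem_comap, ha]; exact J.mul_mem_left _ hx)
  -- `x = (2m + 1)x - m(2x)`.
  convert Ideal.sub_mem _ (Ideal.mul_mem_left _ x h1) (Ideal.mul_mem_left _ (m : O) h2) using 1
  push_cast
  ring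

theorem comap_mul_comap (h : IsHalfOrder f r w k) {J K : Ideal O} {m : ℤ}
    (hJK : J * K = Ideal.span {((2 * m + 1 : ℤ) : O)}) :
    J.comap f * K.comap f = Ideal.span {((2 * m + 1 : ℤ) : A)} := by
  have hn : ((2 * m + 1 : ℤ) : O) ∈ J * K := hJK ▸ Ideal.mem_span_singleton_self _
  have hnJ : ((2 * m + 1 : ℤ) : A) ∈ J.comap f := by
    rw [Ideal.mem_comap, map_intCast]; exact Ideal.mul_le_left hn
  have hnK : ((2 * m + 1 : ℤ) : A) ∈ K.comap f := by
    rw [Ideal.mem_comap, map_intCast]; exact Ideal.mul_le_right hn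
  apply le_antisymm
  · rw [Ideal.mul_le]
    intro p hp q hq
    have hpq : f (p * q) ∈ Ideal.span {((2 * m + 1 : ℤ) : O)} := by
      rw [map_mul, ← hJK]; exact Ideal.mul_mem_mul hp hq
    obtain ⟨y, hy⟩ := Ideal.mem_span_singleton.mp hpq
    obtain ⟨a, ha⟩ := h.two_mul_mem_range y
    -- With `pq = (2m + 1)y`, the quotient `y = pq - m(2y)` lies in `A`.
    refine Ideal.mem_span_singleton.mpr ⟨p * q - m * a, h.injective ?_⟩
    simp only [map_mul, map_sub, map_intCast, ha] at hy ⊢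
    push_cast at hy ⊢
    linear_combination (-2 * (m : O)) * hy
  · rw [Ideal.span_singleton_le_iff_mem]
    have key : ∀ g ∈ J * K, ∃ q ∈ J.comap f * K.comap f, f q = 4 * g := by
      intro g hg
      induction hg using Submodule.mul_induction_on' with
      | mem_mul_mem x hx y hy =>
        obtain ⟨a, ha⟩ := h.two_mul_mem_range x
        obtain ⟨b, hb⟩ := h.two_mul_mem_range y
        refine ⟨a * b, Ideal.mul_mem_mul ?_ ?_, by rw [map_mul, ha, hb]; ring⟩
        · rw [Ideal.mem_comap, ha]; exact J.mul_mem_left _ hx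
        · rw [Ideal.mem_comap, hb]; exact K.mul_mem_left _ hy
      | add x _ y _ hx hy =>
        obtain ⟨i, hi, hi'⟩ := hx
        obtain ⟨j, hj, hj'⟩ := hy
        exact ⟨i + j, Ideal.add_mem _ hi hj, by rw [map_add, hi', hj']; ring⟩
    obtain ⟨q, hq, hq'⟩ := key _ hn
    have hq4 : q = 4 * ((2 * m + 1 : ℤ) : A) := h.injective (by
      rw [hq', map_mul, map_ofNat, map_intCast])
    -- With `n = 2m + 1`, both `n²` and `4n` lie in the product, and `n · n² - (m² + m) · 4n = n`.
    convert Ideal.sub_mem _ (Ideal.mul_mem_left _ ((2 * m + 1 : ℤ) : A)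
      (Ideal.mul_mem_mul hnJ hnK)) (Ideal.mul_mem_left _ ((m * m + m : ℤ) : A) hq) using 1
    rw [hq4]
    push_cast
    ring

/-- Dividing `J` by the largest power of `(2)` leaves an ideal containing an odd integer, which
therefore divides that integer's principal ideal; `I` and `I'` are the contractions of the two
factors. -/
theorem exists_map_eq [IsDedekindDomain O] (h : IsHalfOrder f r w k) {J : Ideal O}
    (hJ : J ≠ 0) : ∃ (I I' : Ideal A) (a : A) (x : O), a ≠ 0 ∧ x ≠ 0 ∧
      I * I' = Ideal.span {a} ∧ Ideal.span {x} * I.map f = J := by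
  have hunit : ¬ IsUnit (Ideal.span {(2 : O)}) := by
    rw [Ideal.isUnit_iff, Ideal.span_singleton_eq_top, isUnit_iff_exists_inv]
    rintro ⟨y, hy⟩
    exact h.two_mul_ne_one y hy
  obtain ⟨n, J', hJ', rfl⟩ := WfDvdMonoid.max_power_factor' hJ hunit
  obtain ⟨m, hm⟩ := h.exists_odd_mem (Ideal.dvd_iff_le.not.mp hJ')
  obtain ⟨K, hK⟩ := Ideal.dvd_span_singleton.mpr hm
  refine ⟨J'.comap f, K.comap f, _, 2 ^ n, h.intCast_ne_zero (by omega),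
    pow_ne_zero n h.two_ne_zero, h.comap_mul_comap hK.symm, ?_⟩
  rw [h.map_comap hm, Ideal.span_singleton_pow]

end IsHalfOrder


/-! ### The class group homomorphism on classes of ideals -/

section ClassGroup

variable {A B : Type*} [CommRing A] [IsDomain A] [CommRing B]

theorem classGroupMk_eq_quotientMk (u : (FractionalIdeal A⁰ (FractionRing A))ˣ) :
    ClassGroup.mk (FractionRing A) u = QuotientGroup.mk u := by
  rw [ClassGroup.mk_def, FractionalIdeal.canonicalEquiv_self]
  rfl

theorem exists_idealClass_eq (c : ClassGroup A) :
    ∃ (I : Ideal A) (hI : IsUnit (I : FractionalIdeal A⁰ (FractionRing A))),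
      idealClass I hI = c := by
  refine ClassGroup.induction (FractionRing A) (fun I => ?_) c
  have hI := FractionalIdeal.isUnit_num.mpr I.isUnit
  refine ⟨_, hI, Eq.symm (ClassGroup.mk_eq_mk.mpr ?_)⟩
  have hden : algebraMap A (FractionRing A) I.1.den ≠ 0 :=
    IsFractionRing.to_map_ne_zero_of_mem_nonZeroDivisors (SetLike.coe_mem _)
  refine ⟨Units.mk0 _ hden, Units.ext ?_⟩
  rw [mul_comm, Units.val_mul, coe_toPrincipalIdeal, Units.val_mk0, IsUnit.unit_spec]
  exact FractionalIdeal.den_mul_self_eq_num' A⁰ (FractionRing A) I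

/-- Clearing the denominator of the inverse turns invertibility into a statement about integral
ideals. -/
theorem exists_mul_eq_span_of_isUnit {I : Ideal A}
    (hI : IsUnit (I : FractionalIdeal A⁰ (FractionRing A))) :
    ∃ (J : Ideal A) (a : A), a ≠ 0 ∧ I * J = Ideal.span {a} := by
  obtain ⟨K, hK⟩ := hI.exists_right_inv
  refine ⟨K.num, K.den, nonZeroDivisors.coe_ne_zero _, ?_⟩
  rw [← FractionalIdeal.coeIdeal_inj (K := FractionRing A), FractionalIdeal.coeIdeal_mul,
    ← FractionalIdeal.den_mul_self_eq_num', mul_left_comm, hK, mul_one,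
    FractionalIdeal.coeIdeal_span_singleton]

theorem isUnit_of_mul_eq_span {I J : Ideal A} {a : A} (ha : a ≠ 0)
    (h : I * J = Ideal.span {a}) :
    IsUnit (I : FractionalIdeal A⁰ (FractionRing A)) := by
  have ha' : algebraMap A (FractionRing A) a ≠ 0 :=
    (map_ne_zero_iff _ (IsFractionRing.injective A (FractionRing A))).mpr ha
  refine IsUnit.of_mul_eq_one ((J : FractionalIdeal A⁰ (FractionRing A)) *
      FractionalIdeal.spanSingleton _ (algebraMap A (FractionRing A) a)⁻¹) ?_
  rw [← mul_assoc, ← FractionalIdeal.coeIdeal_mul, h,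
    FractionalIdeal.coeIdeal_span_singleton, FractionalIdeal.spanSingleton_mul_spanSingleton,
    mul_inv_cancel₀ ha', FractionalIdeal.spanSingleton_one]

theorem idealClass_eq_one_iff {I : Ideal A}
    (hI : IsUnit (I : FractionalIdeal A⁰ (FractionRing A))) :
    idealClass I hI = 1 ↔ ∃ x, x ≠ 0 ∧ I = Ideal.span {x} :=
  ClassGroup.mk_eq_one_of_coe_ideal hI.unit_spec

theorem idealClass_eq_pow_iff {I J : Ideal A}
    (hI : IsUnit (I : FractionalIdeal A⁰ (FractionRing A)))
    (hJ : IsUnit (J : FractionalIdeal A⁰ (FractionRing A))) (n : ℕ) :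
    idealClass I hI = idealClass J hJ ^ n ↔
      ∃ x y, x ≠ 0 ∧ y ≠ 0 ∧ Ideal.span {x} * I = Ideal.span {y} * J ^ n := by
  rw [idealClass, idealClass, ← map_pow]
  refine ClassGroup.mk_eq_mk_of_coe_ideal hI.unit_spec ?_
  rw [Units.val_pow_eq_pow_val, hJ.unit_spec, FractionalIdeal.coeIdeal_pow]

theorem idealClass_pow_eq_one_iff {I : Ideal A}
    (hI : IsUnit (I : FractionalIdeal A⁰ (FractionRing A))) (n : ℕ) :
    idealClass I hI ^ n = 1 ↔ ∃ x, x ≠ 0 ∧ I ^ n = Ideal.span {x} := by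
  rw [idealClass, ← map_pow]
  refine ClassGroup.mk_eq_one_of_coe_ideal ?_
  rw [Units.val_pow_eq_pow_val, hI.unit_spec, FractionalIdeal.coeIdeal_pow]

theorem isUnit_map [IsDomain B] {f : A →+* B} (hf : Function.Injective f) {I : Ideal A}
    (hI : IsUnit (I : FractionalIdeal A⁰ (FractionRing A))) :
    IsUnit (I.map f : FractionalIdeal B⁰ (FractionRing B)) := by
  obtain ⟨J, a, ha, h⟩ := exists_mul_eq_span_of_isUnit hI
  refine isUnit_of_mul_eq_span (J := J.map f) ((map_ne_zero_iff f hf).mpr ha) ?_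
  rw [← Ideal.map_mul, h, Ideal.map_span, Set.image_singleton]

theorem classGroupMap_idealClass [IsDomain B] {f : A →+* B} (hf : Function.Injective f)
    {I : Ideal A} (hI : IsUnit (I : FractionalIdeal A⁰ (FractionRing A))) :
    classGroupMap f hf (idealClass I hI) = idealClass (I.map f) (isUnit_map hf hI) := by
  rw [idealClass, idealClass, classGroupMk_eq_quotientMk, classGroupMk_eq_quotientMk]
  refine congrArg QuotientGroup.mk (Units.ext ?_)
  exact FractionalIdeal.extended_coeIdeal_eq_map _ _ I

namespace IsHalfOrder

variable {f : A →+* B} {r : A} {w : B} {k : ℤ}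

theorem surjective_classGroupMap [IsDedekindDomain B] (h : IsHalfOrder f r w k) :
    Function.Surjective (classGroupMap f h.injective) := by
  intro c
  obtain ⟨J, hJ, rfl⟩ := exists_idealClass_eq c
  have hJ0 : J ≠ 0 := by
    rintro rfl
    exact hJ.ne_zero (by simp)
  obtain ⟨I, I', a, x, ha, hx, hII', hIJ⟩ := h.exists_map_eq hJ0
  have hI := isUnit_of_mul_eq_span ha hII'
  refine ⟨idealClass I hI, ?_⟩
  rw [classGroupMap_idealClass, ← pow_one (idealClass J hJ), idealClass_eq_pow_iff]
  exact ⟨x, 1, hx, one_ne_zero, by simpa using hIJ⟩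

theorem ker_classGroupMap [IsDomain B] (h : IsHalfOrder f r w k)
    (hI : IsUnit ((Ideal.span {4, r + 1} : Ideal A) : FractionalIdeal A⁰ (FractionRing A))) :
    (classGroupMap f h.injective).ker = Subgroup.zpowers (idealClass _ hI) := by
  apply le_antisymm
  · intro c hc
    obtain ⟨I, hI', rfl⟩ := exists_idealClass_eq c
    rw [MonoidHom.mem_ker, classGroupMap_idealClass, idealClass_eq_one_iff] at hc
    obtain ⟨z, hz, hIz⟩ := hc
    obtain ⟨J, a, ha, hIJ⟩ := exists_mul_eq_span_of_isUnit hI'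
    rcases h.trichotomy_of_map_eq_span ha hIJ hz hIz with H | H | H
    · rw [(idealClass_eq_one_iff hI').mpr H]
      exact one_mem _
    · rw [(idealClass_eq_pow_iff hI' hI 1).mpr (by simpa using H)]
      exact Subgroup.npow_mem_zpowers _ _
    · rw [(idealClass_eq_pow_iff hI' hI 2).mpr (by simpa only [pow_two] using H)]
      exact Subgroup.npow_mem_zpowers _ _
  · rw [Subgroup.zpowers_le, MonoidHom.mem_ker, classGroupMap_idealClass, idealClass_eq_one_iff]
    exact ⟨2, h.two_ne_zero, h.map_span⟩

theorem idealClass_pow_three (h : IsHalfOrder f r w k)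
    (hI : IsUnit ((Ideal.span {4, r + 1} : Ideal A) : FractionalIdeal A⁰ (FractionRing A))) :
    idealClass _ hI ^ 3 = 1 :=
  (idealClass_pow_eq_one_iff hI 3).mpr
    ⟨8, by simpa using h.intCast_ne_zero (n := 8) (by norm_num), h.span_pow_three⟩

theorem idealClass_eq_one_iff_unit [IsDomain B] (h : IsHalfOrder f r w k)
    (hI : IsUnit ((Ideal.span {4, r + 1} : Ideal A) : FractionalIdeal A⁰ (FractionRing A))) :
    idealClass _ hI = 1 ↔ ∃ u : Bˣ, ∀ a, f a ≠ u :=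
  (idealClass_eq_one_iff hI).trans h.exists_eq_span_singleton_iff

end IsHalfOrder

end ClassGroup

/-! ### Fundamental units -/

section Units

variable {A B : Type*} [CommRing A] [CommRing B] {f : A →+* B} {g : B →+* ℝ}

/-- Both `ε ^ m` and its inverse lie in `A`, so `ε ^ m = ± ε ^ (e n)`. In `ℝ` positivity excludes
the minus sign, and `ε > 1` allows exponents to be compared. -/
theorem IsFundamentalUnit.dvd_of_mem_range (hf : Function.Injective f) {ε : Bˣ} {η : Aˣ} {e : ℕ}
    (hε : IsFundamentalUnit g ε) (hη : IsFundamentalUnit (g.comp f) η)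
    (he : Units.map f.toMonoidHom η = ε ^ e) {m : ℕ}
    (h1 : ∃ a, f a = ((ε ^ m : Bˣ) : B)) (h2 : ∃ a, f a = (((ε ^ m)⁻¹ : Bˣ) : B)) : e ∣ m := by
  obtain ⟨a, ha⟩ := h1
  obtain ⟨b, hb⟩ := h2
  have hab : a * b = 1 := hf (by rw [map_mul, ha, hb, Units.mul_inv, map_one])
  let v : Aˣ := ⟨a, b, hab, by rw [mul_comm, hab]⟩
  have hv : Units.map f.toMonoidHom v = ε ^ m := Units.ext ha
  let E : ℝˣ := Units.map g.toMonoidHom ε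
  have hE1 : (1 : ℝ) < E := hε.1
  have hE0 : (0 : ℝ) < E := zero_lt_one.trans hE1
  have hvE : Units.map g.toMonoidHom (Units.map f.toMonoidHom v) = E ^ m := by
    rw [hv, map_pow]
  have hηE : Units.map g.toMonoidHom (Units.map f.toMonoidHom η) = E ^ e := by
    rw [he, map_pow]
  obtain ⟨n, hn | hn⟩ := hη.2 v
  · rw [hn, map_zpow, map_zpow, hηE] at hvE
    have := congrArg Units.val hvE
    push_cast at this
    rw [← zpow_natCast, ← zpow_natCast, ← zpow_mul] at this
    have := zpow_right_injective₀ hE0 hE1.ne' this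
    exact Int.natCast_dvd_natCast.mp ⟨n, this.symm⟩
  · have hneg : Units.map g.toMonoidHom (Units.map f.toMonoidHom (-η ^ n)) =
        -(Units.map g.toMonoidHom (Units.map f.toMonoidHom (η ^ n))) := by
      ext; simp
    rw [hn, hneg, map_zpow, map_zpow, hηE] at hvE
    have := congrArg Units.val hvE
    push_cast at this
    have h3 : (0 : ℝ) < E ^ m := pow_pos hE0 m
    have h4 : (0 : ℝ) < ((E : ℝ) ^ e) ^ n := zpow_pos (pow_pos hE0 e) n
    linarith

end Units

/-! ### The ring of integers of `ℚ(√N)` -/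

theorem not_isSquare_of_modEq {N : ℕ} (hN : N ≡ 5 [MOD 8]) : ¬ IsSquare N := by
  rintro ⟨a, rfl⟩
  have : a % 8 < 8 := Nat.mod_lt _ (by norm_num)
  unfold Nat.ModEq at hN
  rw [Nat.mul_mod] at hN
  interval_cases a % 8 <;> omega

theorem exists_eq_add_mul_sqrtN (N : ℕ) (x : QuadField N) :
    ∃ p q : ℚ, x = (p : QuadField N) + q * sqrtN N := by
  have hint : IsIntegral ℚ (√(N : ℝ)) := by
    refine IsIntegral.of_pow (n := 2) (by norm_num) ?_
    rw [Real.sq_sqrt (Nat.cast_nonneg N)]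
    exact isIntegral_algebraMap (R := ℚ) (x := (N : ℚ)) |> fun h => by simpa using h
  obtain ⟨x, hx⟩ := x
  have hx' : x ∈ Algebra.adjoin ℚ {√(N : ℝ)} := by
    rw [← IntermediateField.adjoin_simple_toSubalgebra_of_isAlgebraic hint.isAlgebraic]
    exact hx
  suffices H : ∃ p q : ℚ, x = p + q * √(N : ℝ) by
    obtain ⟨p, q, h⟩ := H
    exact ⟨p, q, Subtype.ext (by simpa [sqrtN] using h)⟩
  clear hx
  induction hx' using Algebra.adjoin_induction with
  | mem x hx => exact ⟨0, 1, by simpa using hx⟩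
  | algebraMap a => exact ⟨a, 0, by simp⟩
  | add x y _ _ hx hy =>
    obtain ⟨p, q, rfl⟩ := hx
    obtain ⟨s, t, rfl⟩ := hy
    exact ⟨p + s, q + t, by push_cast; ring⟩
  | mul x y _ _ hx hy =>
    obtain ⟨p, q, rfl⟩ := hx
    obtain ⟨s, t, rfl⟩ := hy
    refine ⟨p * s + q * t * N, p * t + q * s, ?_⟩
    push_cast
    linear_combination (q * t : ℝ) * Real.mul_self_sqrt (Nat.cast_nonneg (α := ℝ) N)

theorem add_mul_sqrtN_eq_zero {N : ℕ} (hN : ¬ IsSquare N) {p q : ℚ}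
    (h : (p : QuadField N) + q * sqrtN N = 0) : p = 0 ∧ q = 0 := by
  have hirr : Irrational √(N : ℝ) := irrational_sqrt_natCast_iff.mpr hN
  have h' : (p : ℝ) + q * √(N : ℝ) = 0 := by
    simpa [sqrtN] using congrArg Subtype.val h
  have hq : q = 0 := by
    by_contra hq
    refine hirr ⟨-p / q, ?_⟩
    have : (q : ℝ) ≠ 0 := by exact_mod_cast hq
    push_cast
    field_simp
    linarith
  subst hq
  exact ⟨by simpa using h', rfl⟩

theorem exists_int_of_isIntegral {N : ℕ} (hN : ¬ IsSquare N) {p q : ℚ} (hq : q ≠ 0)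
    (hint : IsIntegral ℤ ((p : QuadField N) + q * sqrtN N)) :
    (∃ m : ℤ, 2 * p = m) ∧ ∃ n : ℤ, p ^ 2 - N * q ^ 2 = n := by
  open Polynomial in
  set P : ℚ[X] := X ^ 2 + C (-(2 * p)) * X + C (p ^ 2 - N * q ^ 2) with hP
  have hdeg : P.natDegree = 2 := by rw [hP]; compute_degree!
  have hmonic : P.Monic := by rw [hP]; monicity!
  -- A rational root `t` would give `N = ((t - p) / q)²`.
  have hirr : Irreducible P := by
    rw [hmonic.irreducible_iff_roots_eq_zero_of_degree_le_three (by omega) (by omega)]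
    refine Multiset.eq_zero_of_forall_notMem fun t ht => hN ?_
    have ht' := (Polynomial.mem_roots'.mp ht).2
    simp only [hP, Polynomial.IsRoot.def, Polynomial.eval_add, Polynomial.eval_pow,
      Polynomial.eval_X, Polynomial.eval_mul, Polynomial.eval_C] at ht'
    rw [← Rat.isSquare_natCast_iff]
    refine ⟨(t - p) / q, ?_⟩
    field_simp
    linear_combination -ht'
  have hroot : Polynomial.aeval ((p : QuadField N) + q * sqrtN N) P = 0 := by
    simp only [hP, map_add, map_mul, map_pow, Polynomial.aeval_X, Polynomial.aeval_C, map_neg,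
      map_sub, eq_ratCast, Rat.cast_ofNat, Rat.cast_natCast]
    linear_combination (q : QuadField N) ^ 2 * sqrtN_mul_self N
  have hmin := minpoly.eq_of_irreducible_of_monic hirr hroot hmonic
  -- As `ℤ` is integrally closed, the minimal polynomial over `ℚ` has integer coefficients.
  rw [minpoly.isIntegrallyClosed_eq_field_fractions' ℚ hint] at hmin
  have h1 : P.coeff 1 = -(2 * p) := by
    rw [hP]
    simp only [Polynomial.coeff_add, Polynomial.coeff_X_pow, Polynomial.coeff_C_mul,
      Polynomial.coeff_X, Polynomial.coeff_C]
    norm_num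
  have h0 : P.coeff 0 = p ^ 2 - N * q ^ 2 := by
    rw [hP]
    simp only [Polynomial.coeff_add, Polynomial.coeff_X_pow, Polynomial.coeff_C_mul,
      Polynomial.coeff_X, Polynomial.coeff_C]
    norm_num
  rw [hmin, Polynomial.coeff_map] at h1 h0
  constructor
  · exact ⟨-(minpoly ℤ ((p : QuadField N) + q * sqrtN N)).coeff 1, by
      rw [eq_intCast] at h1; push_cast; linarith⟩
  · exact ⟨_, by rw [← h0, eq_intCast]⟩

/-- The square of the denominator of `t` divides the squarefree `N`. -/
theorem exists_int_of_sq_mul {N : ℕ} (hsq : Squarefree N) {t : ℚ} {n : ℤ}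
    (h : t ^ 2 * N = n) : ∃ l : ℤ, t = l := by
  have hden : (t.den : ℤ) ^ 2 ∣ t.num ^ 2 * N := by
    refine ⟨n, ?_⟩
    have ht : t * t.den = t.num := Rat.mul_den_eq_num t
    have : ((t.num ^ 2 * N : ℤ) : ℚ) = ((t.den ^ 2 * n : ℤ) : ℚ) := by
      push_cast
      rw [← ht, ← h]
      ring
    exact_mod_cast this
  have hcop : IsCoprime ((t.den : ℤ) ^ 2) (t.num ^ 2) := by
    refine IsCoprime.pow ?_
    rw [Int.isCoprime_iff_nat_coprime]
    simpa using t.reduced.symm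
  have hdvd := hcop.dvd_of_dvd_mul_left hden
  have hdvd' : t.den * t.den ∣ N := by
    rw [← pow_two]
    exact_mod_cast hdvd
  have h1 : t.den = 1 := Nat.isUnit_iff.mp (hsq _ hdvd')
  exact ⟨t.num, ((Rat.den_eq_one_iff t).mp h1).symm⟩

instance (N : ℕ) : NumberField (QuadField N) where
  to_charZero := inferInstance
  to_finiteDimensional := by
    refine IntermediateField.adjoin.finiteDimensional (IsIntegral.of_pow (n := 2) (by norm_num) ?_)
    rw [Real.sq_sqrt (Nat.cast_nonneg N)]
    exact isIntegral_algebraMap (R := ℚ) (x := (N : ℚ)) |> fun h => by simpa using h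

theorem half_sq {N : ℕ} {k : ℤ} (hk : (N : ℤ) = 8 * k + 5) :
    ((1 + sqrtN N) / 2) * ((1 + sqrtN N) / 2) = (1 + sqrtN N) / 2 + (2 * k + 1) := by
  have hk' : (N : QuadField N) = 8 * k + 5 := by
    exact_mod_cast congrArg (Int.cast (R := QuadField N)) hk
  have := sqrtN_mul_self N
  rw [hk'] at this
  linear_combination this / 4

theorem isIntegral_half {N : ℕ} {k : ℤ} (hk : (N : ℤ) = 8 * k + 5) :
    IsIntegral ℤ ((1 + sqrtN N) / 2) := by
  open Polynomial in
  refine ⟨X ^ 2 - X - C (2 * k + 1 : ℤ), by monicity!, ?_⟩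
  have := half_sq hk
  rw [Polynomial.eval₂_sub, Polynomial.eval₂_sub, Polynomial.eval₂_pow, Polynomial.eval₂_X,
    Polynomial.eval₂_C, eq_intCast]
  push_cast
  linear_combination this

/-- The integer `(1 + √N) / 2` of `ℚ(√N)`. -/
noncomputable def halfRoot {N : ℕ} {k : ℤ} (hk : (N : ℤ) = 8 * k + 5) : MaxOrder N :=
  ⟨(1 + sqrtN N) / 2, isIntegral_half hk⟩

theorem exists_eq_add_mul_half {N : ℕ} (hsq : Squarefree N) {k : ℤ} (hk : (N : ℤ) = 8 * k + 5)
    {x : QuadField N} (hx : IsIntegral ℤ x) :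
    ∃ a b : ℤ, x = a + b * ((1 + sqrtN N) / 2) := by
  have hN : ¬ IsSquare N := not_isSquare_of_modEq (by unfold Nat.ModEq; omega)
  obtain ⟨p, q, rfl⟩ := exists_eq_add_mul_sqrtN N x
  -- Rational elements are treated apart: their minimal polynomial is linear.
  by_cases hq : q = 0
  · subst hq
    have hp : IsIntegral ℤ p := by
      rw [← isIntegral_algebraMap_iff (algebraMap ℚ (QuadField N)).injective]
      simpa using hx
    obtain ⟨a, ha⟩ := IsIntegrallyClosed.isIntegral_iff.mp hp
    exact ⟨a, 0, by simp [← ha]⟩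
  · obtain ⟨⟨m, hm⟩, n, hn⟩ := exists_int_of_isIntegral hN hq hx
    obtain ⟨l, hl⟩ := exists_int_of_sq_mul hsq (t := 2 * q) (n := m ^ 2 - 4 * n) (by
      push_cast
      rw [← hm, ← hn]
      ring)
    have hml : m ^ 2 - N * l ^ 2 = 4 * n := by
      have : ((m ^ 2 - N * l ^ 2 : ℤ) : ℚ) = ((4 * n : ℤ) : ℚ) := by
        push_cast
        rw [← hm, ← hn, ← hl]
        ring
      exact_mod_cast this
    -- `N` is odd and `m² - N l²` is even, so `m` and `l` have the same parity.
    have heven : Even (m - l) := by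
      have h1 : Even (m ^ 2 - N * l ^ 2) := ⟨2 * n, by rw [hml]; ring⟩
      have hNodd : ¬ Even (N : ℤ) := by rw [hk, Int.not_even_iff_odd]; exact ⟨4 * k + 2, by ring⟩
      simp only [Int.even_sub, Int.even_mul, Int.even_pow] at h1 ⊢
      tauto
    obtain ⟨a, ha⟩ := heven
    refine ⟨a, l, ?_⟩
    have hp : p = (2 * a + l) / 2 := by
      have : (m : ℚ) = 2 * a + l := by
        have : m = 2 * a + l := by omega
        exact_mod_cast this
      rw [← this]; linarith
    have hq : q = l / 2 := by linarith
    rw [hp, hq]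
    push_cast
    ring

theorem isHalfOrder_incl {N : ℕ} (hsq : Squarefree N) {k : ℤ} (hk : (N : ℤ) = 8 * k + 5) :
    IsHalfOrder (incl N) (rootN N) (halfRoot hk) k where
  injective := incl_injective N
  exists_eq x := by
    obtain ⟨a, b, h⟩ := exists_eq_add_mul_half hsq hk x.2
    exact ⟨a, b, NumberField.RingOfIntegers.ext (by
      simp only [map_add, map_mul, map_intCast]
      exact h)⟩
  eq_zero a b h := by
    have hN : ¬ IsSquare N := not_isSquare_of_modEq (by unfold Nat.ModEq; omega)
    have h' : (a : QuadField N) + b * ((1 + sqrtN N) / 2) = 0 := by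
      have h' := congrArg (algebraMap (MaxOrder N) (QuadField N)) h
      rwa [map_add, map_mul, map_intCast, map_intCast, map_zero] at h'
    have := add_mul_sqrtN_eq_zero hN (p := a + b / 2) (q := b / 2) (by
      push_cast
      linear_combination h')
    have hb : (b : ℚ) = 0 := by linarith [this.2]
    have ha : (a : ℚ) = 0 := by linarith [this.1]
    exact ⟨by exact_mod_cast ha, by exact_mod_cast hb⟩
  exists_eq_sub x := by
    suffices H : ∀ y ∈ sqrtSubalgebra N, ∃ a b : ℤ, y = a + b * sqrtN N by
      obtain ⟨a, b, h⟩ := H _ x.2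
      refine ⟨a, b, toField_injective N ?_⟩
      rw [map_add, map_mul, map_intCast, map_intCast]
      exact h
    intro y hy
    induction hy using Algebra.adjoin_induction with
    | mem x hx => exact ⟨0, 1, by simpa using hx⟩
    | algebraMap a => exact ⟨a, 0, by simp⟩
    | add x y _ _ hx hy =>
      obtain ⟨p, q, rfl⟩ := hx
      obtain ⟨s, t, rfl⟩ := hy
      exact ⟨p + s, q + t, by push_cast; ring⟩
    | mul x y _ _ hx hy =>
      obtain ⟨p, q, rfl⟩ := hx
      obtain ⟨s, t, rfl⟩ := hy
      refine ⟨p * s + q * t * N, p * t + q * s, ?_⟩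
      push_cast
      linear_combination (q * t : QuadField N) * sqrtN_mul_self N
  map_root := by
    apply NumberField.RingOfIntegers.ext
    have : algebraMap (MaxOrder N) (QuadField N) (halfRoot hk) = (1 + sqrtN N) / 2 := rfl
    simp only [map_sub, map_mul, map_one, map_ofNat, this]
    change sqrtN N = _
    ring
  sq := by
    apply NumberField.RingOfIntegers.ext
    have : algebraMap (MaxOrder N) (QuadField N) (halfRoot hk) = (1 + sqrtN N) / 2 := rfl
    simp only [map_add, map_mul, map_one, map_ofNat, map_intCast, this]
    exact half_sq hk

/-! ### The unit exponent and the theorem -/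

theorem IsUnitExponent.eq_one_iff {N e : ℕ} (he : IsUnitExponent N e) :
    e = 1 ↔ ∀ u : (MaxOrder N)ˣ, ∃ a, incl N a = u := by
  obtain ⟨ε, η, hε, hη, h⟩ := he
  constructor
  · rintro rfl u
    obtain ⟨n, rfl | rfl⟩ := hε.2 u
    · exact ⟨(η ^ n : (SqrtOrder N)ˣ), by
        rw [← pow_one ε, ← h, ← map_zpow]; rfl⟩
    · exact ⟨-(η ^ n : (SqrtOrder N)ˣ), by
        rw [← pow_one ε, ← h, ← map_zpow, map_neg]; rfl⟩
  · intro H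
    exact Nat.dvd_one.mp
      (IsFundamentalUnit.dvd_of_mem_range (incl_injective N) hε hη h (H _) (H _))

theorem IsUnitExponent.eq_one_or_three {N e : ℕ} (hsq : Squarefree N) {k : ℤ}
    (hk : (N : ℤ) = 8 * k + 5) (he : IsUnitExponent N e) : e = 1 ∨ e = 3 := by
  obtain ⟨ε, η, hε, hη, h⟩ := he
  refine (Nat.dvd_prime Nat.prime_three).mp
    (IsFundamentalUnit.dvd_of_mem_range (incl_injective N) hε hη h ?_ ?_)
  · exact (isHalfOrder_incl hsq hk).unit_pow_three_mem_range ε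
  · rw [← inv_pow]
    exact (isHalfOrder_incl hsq hk).unit_pow_three_mem_range ε⁻¹

end Eisenstein

theorem mainTheorem3 (N : ℕ) (hsq : Squarefree N) (hN : N ≡ 5 [MOD 8])
    (e : ℕ) (he : Eisenstein.IsUnitExponent N e) :
    Function.Surjective (Eisenstein.phi N) ∧
    (Function.Bijective (Eisenstein.phi N) ↔ e = 3) ∧
    ((MonoidHom.ker (Eisenstein.phi N) = Subgroup.zpowers (Eisenstein.classI N hN) ∧
        orderOf (Eisenstein.classI N hN) = 3) ↔ e = 1) := by
  obtain ⟨k, hk⟩ : ∃ k : ℤ, (N : ℤ) = 8 * k + 5 := ⟨N / 8, by unfold Nat.ModEq at hN; omega⟩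
  have h := Eisenstein.isHalfOrder_incl hsq hk
  have hsurj : Function.Surjective (Eisenstein.phi N) := h.surjective_classGroupMap
  have hker : MonoidHom.ker (Eisenstein.phi N) = Subgroup.zpowers (Eisenstein.classI N hN) :=
    h.ker_classGroupMap _
  have hpow : Eisenstein.classI N hN ^ 3 = 1 := h.idealClass_pow_three _
  have hone : Eisenstein.classI N hN = 1 ↔ e ≠ 1 := by
    rw [Ne, he.eq_one_iff, not_forall]
    simp only [not_exists]
    exact h.idealClass_eq_one_iff_unit (Eisenstein.isUnit_idealI N hN)
  have he13 := he.eq_one_or_three hsq hk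
  refine ⟨hsurj, ?_, ?_⟩
  · rw [Function.Bijective, and_iff_left hsurj, ← MonoidHom.ker_eq_bot_iff, hker,
      Subgroup.zpowers_eq_bot, hone]
    omega
  · rw [and_iff_right hker]
    constructor
    · intro h3
      by_contra hne
      rw [hone.mpr hne, orderOf_one] at h3
      omega
    · intro h1
      exact orderOf_eq_prime hpow fun hc => hone.mp hc h1
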